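/- Let $n,k$ be integers with $1\le k\le n-1$. For $\lambda\in\mathbb{R}^n$ put $S_k(\lambda)=\sum_{1\le i_1<\dots<i_k\le n}\lambda_{i_1}\cdots\lambda_{i_k}$, for a real symmetric $n\times n$ matrix $A$ let $S_k(A)$ be the value of $S_k$ at the eigenvalues of $A$ (with multiplicity), and let $\Gamma_k$ be the connected component of $\{\lambda\in\mathbb{R}^n: S_k(\lambda)>0\}$ that contains all $\lambda$ with positive entries. Let $\Omega\subset\mathbb{R}^n$ be a domain (a nonempty connected open set). A function $u\in C^2(\Omega)$ is called $k$-convex if, for every $x\in\Omega$, the vector of eigenvalues of the Hessian matrix $D^2u(x)$ lies in the closure $\overline{\Gamma_k}$. Theorem. Let $\psi:\Omega\times\mathbb{R}\times\mathbb{R}^n\to\mathbb{R}$, and suppose that there are constants $\alpha>1$ and $M>0$ such that $$\psi(x,z,p)\ge M\,(1+|p|^k)^{\alpha}\qquad\text{for all }(x,z,p)\in\Omega\times\mathbb{R}\times\mathbb{R}^n .$$ If $\Omega$ contains a ball of radius $a$, where $$a>\left[\frac{(k+1)\,(n-1)!}{M\,(\alpha-1)\,k!\,(n-k-1)!}\right]^{1/k},$$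 then there is no $k$-convex function $u\in C^2(\Omega)$ that satisfies $$S_k(D^2u(x))=\psi(x,u(x),Du(x))\quad\text{for all }x\in\Omega$$ and $u=+\infty$ on $\partial\Omega$, the latter meaning that $u(x)\to+\infty$ as $x\in\Omega$ and the distance from $x$ to $\partial\Omega$ tends to $0$ (a condition that is void if $\partial\Omega=\emptyset$). -/

import Mathlib

open scoped Nat Topology

noncomputable section

/-- The `k`-th elementary symmetric function
`S_k(λ) = ∑_{i₁ < ⋯ < i_k} λ_{i₁} ⋯ λ_{i_k}` on `ℝⁿ`. -/
def elemSymm {n : ℕ} (k : ℕ) (l : Fin n → ℝ) : ℝ :=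
  ∑ s ∈ Finset.powersetCard k Finset.univ, ∏ i ∈ s, l i

/-- The cone `Γ_k`: the connected component of `{λ ∈ ℝⁿ : S_k(λ) > 0}` that contains the positive
cone, written as the component of the point `(1, …, 1)`; see `posCone_subset_gardingCone`. -/
def gardingCone (n k : ℕ) : Set (Fin n → ℝ) :=
  connectedComponentIn {l : Fin n → ℝ | 0 < elemSymm k l} (fun _ => 1)

/-- For `k ≤ n` the component `Γ_k` contains the whole positive cone. -/
theorem posCone_subset_gardingCone {n k : ℕ} (hk : k ≤ n) :
    {l : Fin n → ℝ | ∀ i, 0 < l i} ⊆ gardingCone n k := by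
  refine IsPreconnected.subset_connectedComponentIn ?_ ?_ ?_
  · refine Convex.isPreconnected ?_
    intro x hx y hy a b ha hb hab i
    have h1 := hx i
    have h2 := hy i
    rcases ha.lt_or_eq with h | h
    · have := mul_pos h h1
      have := mul_nonneg hb h2.le
      simp only [Pi.add_apply, Pi.smul_apply, smul_eq_mul]
      linarith
    · have hb1 : b = 1 := by linarith
      simp [← h, hb1, h2]
  · intro i
    exact one_pos
  · intro l hl
    refine Finset.sum_pos (fun s _ => Finset.prod_pos fun i _ => hl i) ?_
    exact Finset.powersetCard_nonempty.2 (by simpa using hk)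

/-- The eigenvalues, with multiplicity, of a real symmetric matrix
(only used for symmetric matrices; the value `0` at other matrices is irrelevant). -/
def symmEigenvalues {n : ℕ} (A : Matrix (Fin n) (Fin n) ℝ) : Fin n → ℝ :=
  open Classical in if h : A.IsHermitian then h.eigenvalues else 0

/-- The Hessian matrix `D²u(x) = (∂ᵢ ∂ⱼ u(x))`. -/
def hessianMatrix {n : ℕ} (u : EuclideanSpace ℝ (Fin n) → ℝ) (x : EuclideanSpace ℝ (Fin n)) :
    Matrix (Fin n) (Fin n) ℝ :=
  Matrix.of fun i j =>
    fderiv ℝ (fun y => fderiv ℝ u y (EuclideanSpace.single j 1)) x (EuclideanSpace.single i 1)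

/-- The Hessian matrix of a `C²` function on an open set is symmetric. -/
theorem hessianMatrix_isHermitian {n : ℕ} {Ω : Set (EuclideanSpace ℝ (Fin n))} (hΩ : IsOpen Ω)
    {u : EuclideanSpace ℝ (Fin n) → ℝ} (hu : ContDiffOn ℝ 2 u Ω)
    {x : EuclideanSpace ℝ (Fin n)} (hx : x ∈ Ω) : (hessianMatrix u x).IsHermitian := by
  have hc : ContDiffAt ℝ 2 u x := hu.contDiffAt (hΩ.mem_nhds hx)
  have hd : DifferentiableAt ℝ (fderiv ℝ u) x :=
    (hc.fderiv_right (m := 1) (by norm_num)).differentiableAt (by norm_num)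
  have hs : IsSymmSndFDerivAt ℝ u x := hc.isSymmSndFDerivAt (by simp)
  have key : ∀ v w : EuclideanSpace ℝ (Fin n),
      fderiv ℝ (fun y => fderiv ℝ u y v) x w = fderiv ℝ (fderiv ℝ u) x w v := by
    intro v w
    rw [fderiv_clm_apply hd (differentiableAt_const v)]
    simp
  ext i j
  simp only [hessianMatrix, Matrix.conjTranspose_apply, Matrix.of_apply, star_trivial, key]
  exact hs.eq _ _

/-- The Hessian operator `S_k(D²u(x))`: the `k`-th elementary symmetric function of the
eigenvalues of the Hessian matrix. -/
def hessianOperator {n : ℕ} (k : ℕ) (u : EuclideanSpace ℝ (Fin n) → ℝ)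
    (x : EuclideanSpace ℝ (Fin n)) : ℝ :=
  elemSymm k (symmEigenvalues (hessianMatrix u x))

/-- `u` is `k`-convex on `Ω`: the eigenvalues of `D²u(x)` lie in the closure of `Γ_k`
for every `x ∈ Ω`. -/
def IsKConvexOn {n : ℕ} (k : ℕ) (u : EuclideanSpace ℝ (Fin n) → ℝ)
    (Ω : Set (EuclideanSpace ℝ (Fin n))) : Prop :=
  ∀ x ∈ Ω, symmEigenvalues (hessianMatrix u x) ∈ closure (gardingCone n k)

/-- `u = +∞` on `∂Ω`: `u(x) → +∞` as `x ∈ Ω` and `d(x, ∂Ω) → 0`. The distance is extended-valued,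
so that it is `+∞`, and the condition is void, when `∂Ω` is empty. -/
def BlowsUpOnBoundary {n : ℕ} (u : EuclideanSpace ℝ (Fin n) → ℝ)
    (Ω : Set (EuclideanSpace ℝ (Fin n))) : Prop :=
  ∀ K : ℝ, ∃ δ : ℝ, 0 < δ ∧
    ∀ x ∈ Ω, Metric.infEDist x (frontier Ω) < ENNReal.ofReal δ → K < u x

/-- `u` is a `k`-convex solution in `C²(Ω)` of the blow-up problem
`S_k(D²u) = ψ(x, u, Du)` in `Ω`, `u = +∞` on `∂Ω`. -/
structure IsKConvexBlowUpSolution {n : ℕ} (k : ℕ) (Ω : Set (EuclideanSpace ℝ (Fin n)))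
    (ψ : EuclideanSpace ℝ (Fin n) → ℝ → EuclideanSpace ℝ (Fin n) → ℝ)
    (u : EuclideanSpace ℝ (Fin n) → ℝ) : Prop where
  contDiffOn : ContDiffOn ℝ 2 u Ω
  kConvex : IsKConvexOn k u Ω
  equation : ∀ x ∈ Ω, hessianOperator k u x = ψ x (u x) (gradient u x)
  blowUp : BlowsUpOnBoundary u Ω

end

/-! Compare `u` with a radial function v(|x - x₀|) on a ball of radius b slightly below a. Put p =
v', β = 1/(α-1), X = 1 - (r/b)^k, and choose 1 + p^k = X^(-β). Since βα = β + 1, (1 + p^k)^α =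
X^(-(β+1)), while differentiation gives (p/r)^(k-1) p' = E := (β/b^k) X^(-(β+1)). Bernoulli's
inequality gives (p/r)^k ≤ E, hence p/r ≤ p'. Away from the centre D²v has eigenvalues p' (once) and
p/r (n-1 times), so S_k(D²v) ≤ C(n,k) E < M (1 + p^k)^α once C(n,k) β/b^k < M, which the bound on a
guarantees.

As p → ∞ at r = b while Du is bounded on the closed ball, u - v has an interior local maximum
(`exists_isLocalMax_sub_barrier`). There Du = Dv and D²u ≤ D²v, so monotonicity of S_k yields
S_k(D²u) < M (1 + |Du|^k)^α (`exists_hessianOperator_lt`), against the equation. At the centre a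
paraboloid replaces v.

Monotonicity (`elemSymm_mono`) rests on Newton's inequality: Γ_k lies in {S_1, …, S_k > 0}, and
there ∂S_k/∂λ_i, which is S_{k-1} of the other entries, is positive. -/

/-! ### Real-rooted polynomials. -/

open Polynomial in
/-- Rolle: the derivative of a real-rooted polynomial is real-rooted. -/
theorem Polynomial.Splits.derivative_real {p : ℝ[X]} (hp : p.Splits) :
    (derivative p).Splits := by
  rw [splits_iff_card_roots] at hp ⊢
  have h1 := card_roots_le_derivative p
  have h2 := card_roots' (derivative p)
  have h3 := natDegree_derivative_le p
  rcases Nat.eq_zero_or_pos p.natDegree with h | h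
  · rw [eq_C_of_natDegree_eq_zero h]; simp
  · omega

open Polynomial in
theorem Polynomial.Splits.iterate_derivative_real {p : ℝ[X]} (hp : p.Splits) (m : ℕ) :
    (derivative^[m] p).Splits := by
  induction m with
  | zero => exact hp
  | succ m ih => rw [Function.iterate_succ_apply']; exact ih.derivative_real

open Polynomial in
/-- Laguerre's inequality for real-rooted polynomials. -/
theorem Polynomial.Splits.laguerre {p : ℝ[X]} (hp : p.Splits) (x : ℝ) :
    p.eval x * (derivative (derivative p)).eval x ≤ (derivative p).eval x ^ 2 := by
  have key : ∀ s : Multiset ℝ, let q := (s.map fun r => X - C r).prod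
      q.eval x * (derivative (derivative q)).eval x ≤ (derivative q).eval x ^ 2 := by
    intro s
    induction s using Multiset.induction_on with
    | empty => simp
    | cons r s ih =>
      simp only [Multiset.map_cons, Multiset.prod_cons, derivative_mul, derivative_add,
        derivative_sub, derivative_X, derivative_C, sub_zero, one_mul, eval_add, eval_mul,
        eval_sub, eval_X, eval_C] at ih ⊢
      generalize (s.map fun r => X - C r).prod = q at ih ⊢
      -- For P = (X - r) q: P'² - P P'' = q² + (x - r)² (q'² - q q'').
      nlinarith [sq_nonneg (q.eval x), mul_le_mul_of_nonneg_left ih (sq_nonneg (x - r))]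
  have h := hp.eq_prod_roots
  rw [h]
  have := key p.roots
  simp only [derivative_mul, derivative_C, zero_mul, zero_add, eval_mul, eval_C] at this ⊢
  nlinarith [mul_le_mul_of_nonneg_left this (sq_nonneg p.leadingCoeff)]

/-! ### Newton's inequality and its consequences. -/

/-- The `k`-th elementary symmetric function of the entries of `l` with index in `s`. -/
def partialElemSymm {ι : Type*} (s : Finset ι) (k : ℕ) (l : ι → ℝ) : ℝ :=
  ∑ t ∈ s.powersetCard k, ∏ i ∈ t, l i

section partialElemSymm

variable {ι : Type*} (s : Finset ι) (l : ι → ℝ)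

theorem partialElemSymm_zero : partialElemSymm s 0 l = 1 := by
  simp [partialElemSymm]

theorem partialElemSymm_insert [DecidableEq ι] {s : Finset ι} {i : ι} (hi : i ∉ s) (k : ℕ) :
    partialElemSymm (insert i s) (k + 1) l
      = partialElemSymm s (k + 1) l + l i * partialElemSymm s k l := by
  unfold partialElemSymm
  rw [Finset.powersetCard_succ_insert hi, Finset.sum_union, Finset.sum_image, Finset.mul_sum]
  · congr 1
    refine Finset.sum_congr rfl fun t ht => ?_
    rw [Finset.prod_insert fun h => hi ((Finset.mem_powersetCard.1 ht).1 h)]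
  · intro t ht t' ht' h
    have h1 : i ∉ t := fun h => hi ((Finset.mem_powersetCard.1 ht).1 h)
    have h2 : i ∉ t' := fun h => hi ((Finset.mem_powersetCard.1 ht').1 h)
    rw [← Finset.erase_insert h1, ← Finset.erase_insert h2, h]
  · rw [Finset.disjoint_left]
    intro t ht ht'
    obtain ⟨t', -, rfl⟩ := Finset.mem_image.1 ht'
    exact hi ((Finset.mem_powersetCard.1 ht).1 (Finset.mem_insert_self _ _))

theorem partialElemSymm_congr {s : Finset ι} {l l' : ι → ℝ} (h : ∀ i ∈ s, l i = l' i) (k : ℕ) :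
    partialElemSymm s k l = partialElemSymm s k l' :=
  Finset.sum_congr rfl fun _ ht => Finset.prod_congr rfl fun i hi =>
    h i ((Finset.mem_powersetCard.1 ht).1 hi)

open Polynomial in
/-- A weak form of Newton's inequality. -/
theorem partialElemSymm_newton (m : ℕ) :
    partialElemSymm s (m + 2) l * partialElemSymm s m l ≤ partialElemSymm s (m + 1) l ^ 2 := by
  rcases lt_or_ge s.card (m + 2) with h | h
  · have : partialElemSymm s (m + 2) l = 0 := by
      simp [partialElemSymm, Finset.powersetCard_eq_empty.2 h]
    rw [this, zero_mul]
    positivity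
  obtain ⟨d, hd⟩ := Nat.exists_eq_add_of_le h
  set P : ℝ[X] := ∏ i ∈ s, (X + C (l i)) with hP
  have hsp : P.Splits := Splits.prod fun i _ => Splits.X_add_C _
  have hc : ∀ j ≤ m + 2, P.coeff (d + j) = partialElemSymm s (m + 2 - j) l := by
    intro j hj
    rw [hP, Finset.prod_X_add_C_coeff _ _ (by omega), partialElemSymm]
    congr 2
    omega
  have he : ∀ j ≤ m + 2, (derivative^[d + j] P).eval 0
      = ((d + j)! : ℝ) * partialElemSymm s (m + 2 - j) l := by
    intro j hj
    rw [← coeff_zero_eq_eval_zero, coeff_iterate_derivative, zero_add, hc j hj,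
      Nat.descFactorial_self, nsmul_eq_mul]
  -- The d-th derivative of P and its next two derivatives take at 0 the values d! S_{m+2}, (d+1)!
  -- S_{m+1}, (d+2)! S_m.
  have hL := (hsp.iterate_derivative_real d).laguerre 0
  rw [← Function.iterate_succ_apply' derivative, ← Function.iterate_succ_apply' derivative] at hL
  have h0 := he 0 (by omega)
  have h1 := he 1 (by omega)
  have h2 := he 2 (by omega)
  simp only [add_zero, Nat.sub_zero, Nat.add_sub_cancel, Nat.succ_eq_add_one, Nat.add_assoc,
    Nat.reduceAdd, show m + 2 - 1 = m + 1 by omega] at h0 h1 h2 hL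
  rw [h0, h1, h2, Nat.factorial_succ (d + 1), Nat.factorial_succ d] at hL
  have hf : (0 : ℝ) < (d ! : ℝ) := by positivity
  push_cast at hL
  -- Laguerre gives (d+2) S_{m+2} S_m ≤ (d+1) S_{m+1}². The constants may be dropped because the
  -- negated claim makes S_{m+2} S_m positive.
  by_contra! hlt
  set a := partialElemSymm s (m + 2) l
  set b := partialElemSymm s (m + 1) l
  set c := partialElemSymm s m l
  have hd1 : (0 : ℝ) < (d : ℝ) + 1 := by positivity
  have hac : 0 < a * c := lt_of_le_of_lt (sq_nonneg b) hlt
  have h3 : ((d + 1) * (d ! : ℝ) ^ 2) * (((d : ℝ) + 1 + 1) * (a * c))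
      ≤ ((d + 1) * (d ! : ℝ) ^ 2) * ((d + 1) * b ^ 2) := by nlinarith
  have h4 := le_of_mul_le_mul_left h3 (by positivity)
  nlinarith

/-- Let a, b, c be S_{j+2}, S_{j+1}, S_j of `s`, with c > 0 by induction. If b ≤ 0, then adding (a +
l_i b) c > 0 and (b + l_i c)(-b) ≥ 0 gives ac > b², against Newton. -/
theorem partialElemSymm_pos_of_insert [DecidableEq ι] {s : Finset ι} {l : ι → ℝ} {i : ι}
    (hi : i ∉ s) {k : ℕ} (h : ∀ j ≤ k, 0 < partialElemSymm (insert i s) j l) :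
    ∀ j < k, 0 < partialElemSymm s j l := by
  intro j
  induction j with
  | zero => simp [partialElemSymm_zero]
  | succ j ih =>
    intro hj
    have h0 := ih (by omega)
    have h1 := h (j + 1) hj.le
    have h2 := h (j + 2) hj
    have hN := partialElemSymm_newton s l j
    rw [partialElemSymm_insert l hi] at h1 h2
    by_contra! hle
    rw [add_assoc] at h2
    norm_num at h2
    set a := partialElemSymm s (j + 2) l
    set b := partialElemSymm s (j + 1) l
    set c := partialElemSymm s j l
    nlinarith [mul_pos h2 h0, mul_nonneg h1.le (neg_nonneg.2 hle)]

/-- Along the region where `S_1, …, S_k` are positive, `S_{j+1} ≤ S_1 S_j`. -/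
theorem partialElemSymm_succ_le {k : ℕ} (h : ∀ j ≤ k, 0 < partialElemSymm s j l) :
    ∀ j < k, partialElemSymm s (j + 1) l ≤ partialElemSymm s 1 l * partialElemSymm s j l := by
  intro j
  induction j with
  | zero => simp [partialElemSymm_zero]
  | succ j ih =>
    intro hj
    have h0 := ih (by omega)
    have hN := partialElemSymm_newton s l j
    have hp := h j (by omega)
    have hp1 := h (j + 1) (by omega)
    -- S_{j+2} S_j ≤ S_{j+1}² ≤ S_1 S_j S_{j+1}; cancel S_j.
    refine le_of_mul_le_mul_right ?_ hp
    nlinarith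

end partialElemSymm

/-! ### The cone Γ_k and monotonicity of S_k. -/

theorem elemSymm_eq_partialElemSymm {n : ℕ} (k : ℕ) (l : Fin n → ℝ) :
    elemSymm k l = partialElemSymm Finset.univ k l := rfl

theorem elemSymm_zero {n : ℕ} (l : Fin n → ℝ) : elemSymm 0 l = 1 := by
  simp [elemSymm]

theorem continuous_elemSymm {n : ℕ} (k : ℕ) : Continuous fun l : Fin n → ℝ => elemSymm k l := by
  unfold elemSymm
  fun_prop

/-- On the closure of the region where `S_1, …, S_k` are positive, `S_k > 0` forces
`S_1, …, S_k > 0`. -/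
theorem elemSymm_pos_of_mem_closure {n k : ℕ} {l : Fin n → ℝ}
    (hl : l ∈ closure {l : Fin n → ℝ | ∀ j ≤ k, 0 < elemSymm j l}) (hk : 0 < elemSymm k l) :
    ∀ j ≤ k, 0 < elemSymm j l := by
  have hsub : closure {l : Fin n → ℝ | ∀ j ≤ k, 0 < elemSymm j l} ⊆
      {l | (∀ j ≤ k, 0 ≤ elemSymm j l) ∧
        ∀ j < k, elemSymm (j + 1) l ≤ elemSymm 1 l * elemSymm j l} := by
    refine closure_minimal (fun l hl => ⟨fun j hj => (hl j hj).le,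
      partialElemSymm_succ_le _ _ hl⟩) ?_
    rw [Set.ofPred_and]
    refine IsClosed.inter ?_ ?_
    · simp only [Set.ofPred_forall]
      exact isClosed_iInter fun j => isClosed_iInter fun _ =>
        isClosed_le continuous_const (continuous_elemSymm j)
    · simp only [Set.ofPred_forall]
      exact isClosed_iInter fun j => isClosed_iInter fun _ =>
        isClosed_le (continuous_elemSymm _) ((continuous_elemSymm _).mul (continuous_elemSymm _))
  obtain ⟨h0, h1⟩ := hsub hl
  -- Descend from S_k: if S_j vanished, S_{j+1} ≤ S_1 S_j would contradict S_{j+1} > 0.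
  have key : ∀ i ≤ k, 0 < elemSymm (k - i) l := by
    intro i
    induction i with
    | zero => simpa using hk
    | succ i ih =>
      intro hi
      have hp := ih (by omega)
      have hle := h1 (k - (i + 1)) (by omega)
      rw [show k - (i + 1) + 1 = k - i by omega] at hle
      refine lt_of_le_of_ne (h0 _ (by omega)) fun h => ?_
      rw [← h, mul_zero] at hle
      linarith
  intro j hj
  have := key (k - j) (by omega)
  rwa [Nat.sub_sub_self hj] at this

/-- By `elemSymm_pos_of_mem_closure` the open region on the right is also relatively closed in {S_k
> 0}, so a connected set through (1, …, 1) cannot leave it. -/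
theorem gardingCone_subset {n k : ℕ} (hk : k ≤ n) :
    gardingCone n k ⊆ {l : Fin n → ℝ | ∀ j ≤ k, 0 < elemSymm j l} := by
  have h1 : ∀ j ≤ n, 0 < elemSymm j (fun _ : Fin n => (1 : ℝ)) := by
    intro j hj
    refine Finset.sum_pos (fun s _ => Finset.prod_pos fun i _ => one_pos) ?_
    exact Finset.powersetCard_nonempty.2 (by simpa using hj)
  refine isPreconnected_connectedComponentIn.subset_of_closure_inter_subset ?_ ?_ ?_
  · simp only [Set.ofPred_forall]
    have : (⋂ j, ⋂ (_ : j ≤ k), {l : Fin n → ℝ | 0 < elemSymm j l})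
        = ⋂ j ∈ Finset.range (k + 1), {l : Fin n → ℝ | 0 < elemSymm j l} := by
      simp
    rw [this]
    exact isOpen_biInter_finset fun j _ => isOpen_lt continuous_const (continuous_elemSymm j)
  · exact ⟨fun _ => 1, mem_connectedComponentIn (h1 k hk), fun j hj => h1 j (hj.trans hk)⟩
  · rintro l ⟨hl, hl'⟩
    exact elemSymm_pos_of_mem_closure hl
      (show l ∈ {l | 0 < elemSymm k l} from connectedComponentIn_subset _ _ hl')

theorem elemSymm_pos_of_mem_closure_gardingCone {n k : ℕ} (hkn : k ≤ n) {l : Fin n → ℝ}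
    (hl : l ∈ closure (gardingCone n k)) (hk : 0 < elemSymm k l) :
    ∀ j ≤ k, 0 < elemSymm j l :=
  elemSymm_pos_of_mem_closure (closure_mono (gardingCone_subset hkn) hl) hk

/-- S_{j+1} is affine in the i-th entry, and its slope is S_j of the other entries, positive by
`partialElemSymm_pos_of_insert`. -/
theorem elemSymm_le_update {n k : ℕ} {l : Fin n → ℝ} (hl : ∀ j ≤ k, 0 < elemSymm j l)
    (i : Fin n) {x : ℝ} (hx : l i ≤ x) :
    ∀ j ≤ k, elemSymm j l ≤ elemSymm j (Function.update l i x) := by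
  have hi : i ∉ Finset.univ.erase i := Finset.notMem_erase _ _
  have huniv : insert i (Finset.univ.erase i) = (Finset.univ : Finset (Fin n)) :=
    Finset.insert_erase (Finset.mem_univ i)
  intro j hj
  rcases j with _ | j
  · simp [elemSymm_zero]
  have hpos : 0 < partialElemSymm (Finset.univ.erase i) j l := by
    refine partialElemSymm_pos_of_insert hi (k := k) ?_ j hj
    rwa [huniv]
  have hc := partialElemSymm_congr (s := Finset.univ.erase i) (l := Function.update l i x) (l' := l)
    fun m hm => Function.update_of_ne (Finset.ne_of_mem_erase hm) _ _
  rw [elemSymm_eq_partialElemSymm, elemSymm_eq_partialElemSymm, ← huniv,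
    partialElemSymm_insert _ hi, partialElemSymm_insert _ hi, hc, hc, Function.update_self]
  have := mul_le_mul_of_nonneg_right hx hpos.le
  linarith

/-- `S_k` is monotone on the region where `S_1, …, S_k` are positive. -/
theorem elemSymm_mono {n k : ℕ} {l m : Fin n → ℝ} (hl : ∀ j ≤ k, 0 < elemSymm j l)
    (h : l ≤ m) : elemSymm k l ≤ elemSymm k m := by
  -- Entries are raised one at a time; all orders j ≤ k are carried along so that positivity
  -- survives to the next step.
  have key : ∀ s : Finset (Fin n), ∀ j ≤ k, elemSymm j l ≤ elemSymm j (s.piecewise m l) := by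
    intro s
    induction s using Finset.induction_on with
    | empty => simp
    | insert i s hi ih =>
      intro j hj
      refine (ih j hj).trans ?_
      rw [Finset.piecewise_insert]
      refine elemSymm_le_update (fun j hj => (hl j hj).trans_le (ih j hj)) i ?_ j hj
      rw [Finset.piecewise_eq_of_notMem _ _ _ hi]
      exact h i
  simpa using key Finset.univ k le_rfl

/-! ### Eigenvalue bounds from the quadratic form. -/

/-- If the form `A` is bounded by `G` everywhere and by `g` on the orthogonal complement of `e`,
all its eigenvalues are at most `g`, up to one which is at most `G`. -/
theorem Matrix.IsHermitian.exists_eigenvalues_le {n : ℕ} [NeZero n]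
    {A : Matrix (Fin n) (Fin n) ℝ} (hA : A.IsHermitian) (e : Fin n → ℝ) {g G : ℝ}
    (hG : ∀ w, w ⬝ᵥ A.mulVec w ≤ G * (w ⬝ᵥ w))
    (hg : ∀ w, e ⬝ᵥ w = 0 → w ⬝ᵥ A.mulVec w ≤ g * (w ⬝ᵥ w)) :
    ∃ i, hA.eigenvalues i ≤ G ∧ ∀ j ≠ i, hA.eigenvalues j ≤ g := by
  obtain ⟨i, hi⟩ := Finite.exists_max hA.eigenvalues
  set b : Fin n → Fin n → ℝ := fun i => (hA.eigenvectorBasis i).ofLp with hb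
  have hbA : ∀ i, A.mulVec (b i) = hA.eigenvalues i • b i := hA.mulVec_eigenvectorBasis
  have hinner : ∀ i j, b i ⬝ᵥ b j = if i = j then 1 else 0 := by
    intro i j
    have := orthonormal_iff_ite.1 hA.eigenvectorBasis.orthonormal i j
    rw [← this, EuclideanSpace.inner_eq_star_dotProduct, star_trivial, dotProduct_comm]
  refine ⟨i, ?_, fun j hj => ?_⟩
  · have := hG (b i)
    rw [hbA, dotProduct_smul, hinner] at this
    simpa using this
  -- Otherwise two eigenvalues exceed g, so the form exceeds g on the plane of their eigenvectors;
  -- that plane contains a nonzero vector orthogonal to e.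
  · by_contra! hlt
    have hlt' : g < hA.eigenvalues i := hlt.trans_le (hi j)
    have hform : ∀ s t : ℝ, e ⬝ᵥ (s • b i + t • b j) = 0 →
        s ^ 2 * hA.eigenvalues i + t ^ 2 * hA.eigenvalues j ≤ g * (s ^ 2 + t ^ 2) := by
      intro s t h
      have := hg _ h
      simp only [Matrix.mulVec_add, Matrix.mulVec_smul, hbA, dotProduct_add, add_dotProduct,
        dotProduct_smul, smul_dotProduct, hinner, smul_eq_mul, if_pos, if_neg hj,
        if_neg hj.symm] at this
      linarith
    by_cases h0 : e ⬝ᵥ b i = 0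
    · have := hform 1 0 (by simp [h0])
      nlinarith
    · have := hform (e ⬝ᵥ b j) (-(e ⬝ᵥ b i)) (by
        rw [dotProduct_add, dotProduct_smul, dotProduct_smul, smul_eq_mul, smul_eq_mul]; ring)
      have hp : 0 < (e ⬝ᵥ b i) ^ 2 := by positivity
      nlinarith [mul_pos hp (sub_pos.2 hlt), mul_nonneg (sq_nonneg (e ⬝ᵥ b j)) (sub_pos.2 hlt').le]

theorem elemSymm_le_choose_mul {n k : ℕ} (i : Fin n) {g G E : ℝ}
    (hgE : g ^ k ≤ E) (hGE : g ^ (k - 1) * G ≤ E) :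
    elemSymm k (Function.update (fun _ => g) i G) ≤ n.choose k * E := by
  have : ((Finset.univ : Finset (Fin n)).powersetCard k).card = n.choose k := by simp
  rw [elemSymm, ← this, ← nsmul_eq_mul]
  refine Finset.sum_le_card_nsmul _ _ _ fun s hs => ?_
  obtain ⟨-, hs⟩ := Finset.mem_powersetCard.1 hs
  by_cases hi : i ∈ s
  · rw [Finset.prod_update_of_mem hi, Finset.prod_const,
      Finset.card_sdiff_of_subset (by simpa using hi), hs, Finset.card_singleton, mul_comm]
    exact hGE
  · rw [Finset.prod_update_of_notMem hi, Finset.prod_const, hs]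
    exact hgE

/-- A bound for `S_k(A)` in terms of bounds for the quadratic form `A`. -/
theorem elemSymm_symmEigenvalues_le {n k : ℕ} [NeZero n] (hkn : k ≤ n)
    {A : Matrix (Fin n) (Fin n) ℝ} (hA : A.IsHermitian)
    (hcone : symmEigenvalues A ∈ closure (gardingCone n k))
    (hpos : 0 < elemSymm k (symmEigenvalues A)) (e : Fin n → ℝ) {g G E : ℝ}
    (hG : ∀ w, w ⬝ᵥ A.mulVec w ≤ G * (w ⬝ᵥ w))
    (hg : ∀ w, e ⬝ᵥ w = 0 → w ⬝ᵥ A.mulVec w ≤ g * (w ⬝ᵥ w))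
    (hgE : g ^ k ≤ E) (hGE : g ^ (k - 1) * G ≤ E) :
    elemSymm k (symmEigenvalues A) ≤ n.choose k * E := by
  obtain ⟨i, hi, hj⟩ := hA.exists_eigenvalues_le e hG hg
  refine le_trans (elemSymm_mono (elemSymm_pos_of_mem_closure_gardingCone hkn hcone hpos)
    fun j => ?_) (elemSymm_le_choose_mul i hgE hGE)
  rw [symmEigenvalues, dif_pos hA]
  by_cases h : j = i
  · rw [h, Function.update_self]; exact hi
  · rw [Function.update_of_ne h]; exact hj j h

/-! ### Second-order conditions along lines. -/

/-- Necessary conditions of first and second order at a local maximum. -/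
theorem IsLocalMax.hasDerivAt_second_nonpos {f f' : ℝ → ℝ} {c x : ℝ} (h : IsLocalMax f x)
    (hf : ∀ᶠ t in 𝓝 x, HasDerivAt f (f' t) t) (hf' : HasDerivAt f' c x) :
    f' x = 0 ∧ c ≤ 0 := by
  have h0 : f' x = 0 := h.hasDerivAt_eq_zero hf.self_of_nhds
  refine ⟨h0, ?_⟩
  by_contra! hc
  have hd : deriv f =ᶠ[𝓝 x] f' := hf.mono fun t ht => ht.deriv
  have hdd : deriv (deriv f) x = c := by rw [hd.deriv_eq, hf'.deriv]
  -- With c > 0 the point would also be a local minimum, so f would be locally constant and c = 0.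
  have hmin := isLocalMin_of_deriv_deriv_pos (by rw [hdd]; exact hc)
    (by rw [hd.self_of_nhds, h0]) hf.self_of_nhds.continuousAt
  have hconst : f =ᶠ[𝓝 x] fun _ => f x := by
    filter_upwards [h, hmin] with t h1 h2 using le_antisymm h1 h2
  have : deriv (deriv f) x = 0 := by
    rw [hconst.deriv.deriv_eq]; simp
  linarith

section Hessian

variable {n : ℕ} {Ω : Set (EuclideanSpace ℝ (Fin n))} {u : EuclideanSpace ℝ (Fin n) → ℝ}

theorem hasDerivAt_fderiv_line (hΩ : IsOpen Ω) (hu : ContDiffOn ℝ 2 u Ω)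
    {x : EuclideanSpace ℝ (Fin n)} (hx : x ∈ Ω) (w : EuclideanSpace ℝ (Fin n)) :
    HasDerivAt (fun t : ℝ => fderiv ℝ u (x + t • w) w)
      (w.ofLp ⬝ᵥ (hessianMatrix u x).mulVec w.ofLp) 0 := by
  have hc : ContDiffAt ℝ 2 u x := hu.contDiffAt (hΩ.mem_nhds hx)
  have hd : DifferentiableAt ℝ (fderiv ℝ u) x :=
    (hc.fderiv_right (m := 1) (by norm_num)).differentiableAt (by norm_num)
  have hline : HasDerivAt (fun t : ℝ => x + t • w) w 0 := by
    simpa using ((hasDerivAt_id (0 : ℝ)).smul_const w).const_add x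
  have h1 : HasDerivAt (fun t : ℝ => fderiv ℝ u (x + t • w)) (fderiv ℝ (fderiv ℝ u) x w) 0 := by
    refine HasFDerivAt.comp_hasDerivAt (0 : ℝ) ?_ hline
    simpa using hd.hasFDerivAt
  have h2 := h1.clm_apply (hasDerivAt_const (0 : ℝ) w)
  suffices h : w.ofLp ⬝ᵥ (hessianMatrix u x).mulVec w.ofLp = fderiv ℝ (fderiv ℝ u) x w w by
    rw [h]; simpa using h2
  have key : ∀ i j, hessianMatrix u x i j = fderiv ℝ (fderiv ℝ u) x
      (EuclideanSpace.single i 1) (EuclideanSpace.single j 1) := by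
    intro i j
    simp only [hessianMatrix, Matrix.of_apply]
    rw [fderiv_clm_apply hd (differentiableAt_const _)]
    simp
  have hw : w = ∑ i, w i • EuclideanSpace.single i (1 : ℝ) := by
    ext j
    simp [Finset.sum_apply, Pi.single_apply]
  conv_rhs => rw [hw]
  simp only [dotProduct, Matrix.mulVec, map_sum, map_smul, sum_apply,
    smul_apply, smul_eq_mul, key, Finset.mul_sum]
  rw [Finset.sum_comm]
  refine Finset.sum_congr rfl fun i _ => Finset.sum_congr rfl fun j _ => ?_
  ring

/-- Touching from above along a line: bounds for the gradient and the Hessian of `u`. -/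
theorem hessianMatrix_le_of_isLocalMax_line (hΩ : IsOpen Ω) (hu : ContDiffOn ℝ 2 u Ω)
    {x : EuclideanSpace ℝ (Fin n)} (hx : x ∈ Ω) (w : EuclideanSpace ℝ (Fin n))
    {f f' : ℝ → ℝ} {c : ℝ} (hf : ∀ᶠ t in 𝓝 0, HasDerivAt f (f' t) t) (hf' : HasDerivAt f' c 0)
    (hmax : IsLocalMax (fun t : ℝ => u (x + t • w) - f t) 0) :
    fderiv ℝ u x w = f' 0 ∧ w.ofLp ⬝ᵥ (hessianMatrix u x).mulVec w.ofLp ≤ c := by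
  have hline : ∀ t, HasDerivAt (fun t : ℝ => x + t • w) w t := fun t => by
    simpa using ((hasDerivAt_id t).smul_const w).const_add x
  have hev : ∀ᶠ t in 𝓝 (0 : ℝ), x + t • w ∈ Ω :=
    (hline 0).continuousAt.eventually_mem (by simpa using hΩ.mem_nhds hx)
  have hd : ∀ᶠ t in 𝓝 (0 : ℝ), HasDerivAt (fun t : ℝ => u (x + t • w) - f t)
      (fderiv ℝ u (x + t • w) w - f' t) t := by
    filter_upwards [hev, hf] with t ht ht'
    have hdiff : DifferentiableAt ℝ u (x + t • w) :=
      (hu.contDiffAt (hΩ.mem_nhds ht)).differentiableAt (by norm_num)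
    exact (hdiff.hasFDerivAt.comp_hasDerivAt t (hline t)).sub ht'
  have := hmax.hasDerivAt_second_nonpos hd ((hasDerivAt_fderiv_line hΩ hu hx w).sub hf')
  simp only [zero_smul, add_zero] at this
  exact ⟨by linarith [this.1], by linarith [this.2]⟩

end Hessian

/-! ### The radial barrier. -/

/-- Bernoulli's inequality in the form needed for the radial barrier. -/
theorem rpow_neg_sub_one_le {β X : ℝ} (hβ : 0 < β) (hX : 0 < X) :
    X ^ (-β) - 1 ≤ β * (1 - X) * X ^ (-(β + 1)) := by
  -- X^(β+1) lies above its tangent line at 1; then multiply by X^(-(β+1)).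
  have h := one_add_mul_self_le_rpow_one_add (s := X - 1) (by linarith) (p := β + 1) (by linarith)
  have h1 : X ^ (-β) = X * X ^ (-(β + 1)) := by
    rw [← Real.rpow_one_add' hX.le (by simpa using hβ.ne')]
    congr 1; ring
  have h2 : X ^ (β + 1) * X ^ (-(β + 1)) = 1 := by
    rw [← Real.rpow_add hX]; simp
  rw [add_sub_cancel] at h
  have h3 := mul_le_mul_of_nonneg_right h (Real.rpow_nonneg hX.le (-(β + 1)))
  rw [h2] at h3
  rw [h1]
  linarith

/-- The slope of the radial barrier: `p(r)^k = (1 - (r/b)^k)^{-β} - 1`. -/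
noncomputable def barrierSlope (k : ℕ) (β b r : ℝ) : ℝ :=
  ((1 - |r| ^ k / b ^ k) ^ (-β) - 1) ^ (1 / (k : ℝ))

/-- The radial barrier. -/
noncomputable def barrier (k : ℕ) (β b r : ℝ) : ℝ := ∫ t in (0 : ℝ)..r, barrierSlope k β b t

section Barrier

variable {k : ℕ} {β b r : ℝ}

theorem one_sub_pow_div_pos (hk : k ≠ 0) (hb : 0 < b) (hr : |r| < b) :
    0 < 1 - |r| ^ k / b ^ k := by
  rw [sub_pos, div_lt_one (by positivity)]
  exact pow_lt_pow_left₀ hr (abs_nonneg r) hk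

theorem one_sub_pow_div_le_one (hb : 0 < b) : 1 - |r| ^ k / b ^ k ≤ 1 := by
  have : 0 ≤ |r| ^ k / b ^ k := by positivity
  linarith

theorem barrierSlope_base_nonneg (hk : k ≠ 0) (hβ : 0 < β) (hb : 0 < b) (hr : |r| < b) :
    0 ≤ (1 - |r| ^ k / b ^ k) ^ (-β) - 1 :=
  sub_nonneg.2 <| Real.one_le_rpow_of_pos_of_le_one_of_nonpos (one_sub_pow_div_pos hk hb hr)
    (one_sub_pow_div_le_one hb) (by linarith)

theorem barrierSlope_pow (hk : k ≠ 0) (hβ : 0 < β) (hb : 0 < b) (hr : |r| < b) :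
    barrierSlope k β b r ^ k = (1 - |r| ^ k / b ^ k) ^ (-β) - 1 := by
  rw [barrierSlope, one_div, Real.rpow_inv_natCast_pow (barrierSlope_base_nonneg hk hβ hb hr) hk]

/-- Bernoulli with 1 - X = |r|^k / b^k. For r > 0 this bounds the k-th power of the tangential
curvature p/r by E. -/
theorem barrierSlope_pow_le (hk : k ≠ 0) (hβ : 0 < β) (hb : 0 < b) (hr : |r| < b) :
    barrierSlope k β b r ^ k
      ≤ |r| ^ k * (β / b ^ k * (1 - |r| ^ k / b ^ k) ^ (-(β + 1))) := by
  rw [barrierSlope_pow hk hβ hb hr]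
  refine (rpow_neg_sub_one_le hβ (one_sub_pow_div_pos hk hb hr)).trans_eq ?_
  ring

theorem continuousOn_barrierSlope (hk : k ≠ 0) (hb : 0 < b) :
    ContinuousOn (barrierSlope k β b) (Set.Ioo (-b) b) := by
  unfold barrierSlope
  -- The base vanishes at r = 0, so continuity there comes from the exponent 1/k being nonnegative.
  refine ContinuousOn.rpow_const ?_ fun _ _ => Or.inr (by positivity)
  refine ContinuousOn.sub (ContinuousOn.rpow_const (by fun_prop) fun x hx => Or.inl ?_)
    continuousOn_const
  exact (one_sub_pow_div_pos hk hb (abs_lt.2 hx)).ne'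

theorem hasDerivAt_barrier (hk : k ≠ 0) (hb : 0 < b) (hr : |r| < b) :
    HasDerivAt (barrier k β b) (barrierSlope k β b r) r := by
  have hc := continuousOn_barrierSlope (β := β) hk hb
  have hmem : r ∈ Set.Ioo (-b) b := abs_lt.1 hr
  refine intervalIntegral.integral_hasDerivAt_right ?_ ?_ ?_
  · refine (hc.mono ?_).intervalIntegrable
    refine Set.ordConnected_Ioo.uIcc_subset ⟨by linarith, hb⟩ hmem
  · exact hc.stronglyMeasurableAtFilter isOpen_Ioo r hmem
  · exact hc.continuousAt (isOpen_Ioo.mem_nhds hmem)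

/-- The derivative of `barrierSlope` and the equation it satisfies. -/
theorem exists_hasDerivAt_barrierSlope (hk : k ≠ 0) (hβ : 0 < β) (hb : 0 < b)
    (hr0 : 0 < r) (hr : r < b) :
    ∃ q, HasDerivAt (barrierSlope k β b) q r ∧
      barrierSlope k β b r ^ (k - 1) * q
        = r ^ (k - 1) * (β / b ^ k * (1 - r ^ k / b ^ k) ^ (-(β + 1))) := by
  have hra : |r| < b := by rwa [abs_of_pos hr0]
  have hX := one_sub_pow_div_pos hk hb hra
  rw [abs_of_pos hr0] at hX
  have hX1 : 1 - r ^ k / b ^ k < 1 := by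
    have : 0 < r ^ k / b ^ k := by positivity
    linarith
  have hbase : 0 < (1 - r ^ k / b ^ k) ^ (-β) - 1 :=
    sub_pos.2 (Real.one_lt_rpow_of_pos_of_lt_one_of_neg hX hX1 (by linarith))
  have h1 : HasDerivAt (fun r : ℝ => 1 - r ^ k / b ^ k) (-(k * r ^ (k - 1) / b ^ k)) r :=
    ((hasDerivAt_pow k r).div_const _).const_sub 1
  have h2 := ((h1.rpow_const (p := -β) (Or.inl hX.ne')).sub_const 1).rpow_const
    (p := 1 / (k : ℝ)) (Or.inl hbase.ne')
  have heq : barrierSlope k β b =ᶠ[𝓝 r]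
      fun r => ((1 - r ^ k / b ^ k) ^ (-β) - 1) ^ (1 / (k : ℝ)) := by
    filter_upwards [lt_mem_nhds hr0] with s hs
    rw [barrierSlope, abs_of_pos hs]
  refine ⟨_, h2.congr_of_eventuallyEq heq, ?_⟩
  have hkR : (k : ℝ) ≠ 0 := by exact_mod_cast hk
  -- The exponents of the base cancel: (k-1)/k + (1/k - 1) = 0.
  have hp : barrierSlope k β b r ^ (k - 1)
      * ((1 - r ^ k / b ^ k) ^ (-β) - 1) ^ (1 / (k : ℝ) - 1) = 1 := by
    rw [barrierSlope, abs_of_pos hr0, ← Real.rpow_natCast, ← Real.rpow_mul hbase.le,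
      ← Real.rpow_add hbase, Nat.cast_sub (Nat.one_le_iff_ne_zero.2 hk)]
    rw [show 1 / (k : ℝ) * ((k : ℝ) - (1 : ℕ)) + (1 / (k : ℝ) - 1) = 0 by
      push_cast; field_simp; ring,
      Real.rpow_zero]
  rw [show -β - 1 = -(β + 1) by ring]
  set Y := (1 - r ^ k / b ^ k) ^ (-(β + 1))
  set Z := ((1 - r ^ k / b ^ k) ^ (-β) - 1) ^ (1 / (k : ℝ) - 1)
  calc _ = (barrierSlope k β b r ^ (k - 1) * Z) * (r ^ (k - 1) * (β / b ^ k * Y))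
        * (k * (1 / (k : ℝ))) := by ring
    _ = _ := by rw [hp, mul_one_div_cancel hkR]; ring

theorem barrierSlope_pos (hk : k ≠ 0) (hβ : 0 < β) (hb : 0 < b) (hr0 : 0 < r) (hr : r < b) :
    0 < barrierSlope k β b r := by
  have hra : |r| < b := by rwa [abs_of_pos hr0]
  have hX := one_sub_pow_div_pos hk hb hra
  have : 0 < |r| ^ k / b ^ k := by positivity
  exact Real.rpow_pos_of_pos (sub_pos.2
    (Real.one_lt_rpow_of_pos_of_lt_one_of_neg hX (by linarith) (by linarith))) _

/-- X tends to 0 from above as r → b, so X^(-β) → ∞. This makes the barrier steeper than any C²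
function on the closed ball. -/
theorem exists_lt_barrierSlope (hk : k ≠ 0) (hβ : 0 < β) (hb : 0 < b) (L : ℝ) :
    ∃ r, 0 < r ∧ r < b ∧ L < barrierSlope k β b r := by
  have hX : Filter.Tendsto (fun r : ℝ => 1 - |r| ^ k / b ^ k) (𝓝[<] b) (𝓝[>] 0) := by
    refine tendsto_nhdsWithin_iff.2 ⟨?_, ?_⟩
    · have : ContinuousAt (fun r : ℝ => 1 - |r| ^ k / b ^ k) b := by fun_prop
      have h := this.tendsto
      rw [abs_of_pos hb, div_self (by positivity), sub_self] at h
      exact h.mono_left nhdsWithin_le_nhds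
    · filter_upwards [Ioo_mem_nhdsLT hb] with r hr
      exact one_sub_pow_div_pos hk hb (by rw [abs_of_pos hr.1]; exact hr.2)
  have hT : Filter.Tendsto (barrierSlope k β b) (𝓝[<] b) Filter.atTop := by
    refine (tendsto_rpow_atTop (by positivity)).comp ?_
    exact Filter.tendsto_atTop_add_const_right _ _
      ((tendsto_rpow_neg_nhdsGT_zero (by linarith)).comp hX)
  obtain ⟨r, h2, h1⟩ := ((hT.eventually_gt_atTop L).and (Ioo_mem_nhdsLT hb)).exists
  exact ⟨r, h1.1, h1.2, h2⟩

/-- Near the origin the barrier lies below a paraboloid. -/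
theorem eventually_barrier_le (hk : k ≠ 0) (hβ : 0 < β) (hb : 0 < b) {C : ℝ} (hC : 0 ≤ C)
    (hCk : β / b ^ k < C ^ k) :
    ∀ᶠ r in 𝓝[≥] 0, barrier k β b r ≤ C / 2 * r ^ 2 := by
  have hcont : ContinuousAt (fun r : ℝ => β / b ^ k * (1 - |r| ^ k / b ^ k) ^ (-(β + 1))) 0 := by
    refine continuousAt_const.mul (ContinuousAt.rpow_const (by fun_prop) (Or.inl ?_))
    simp [hk]
  -- The factor in `barrierSlope_pow_le` tends to β/b^k at 0, so near 0 the slope is at most C s;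
  -- integrate.
  have hlt : ∀ᶠ r in 𝓝 (0 : ℝ), β / b ^ k * (1 - |r| ^ k / b ^ k) ^ (-(β + 1)) < C ^ k :=
    hcont.eventually_lt_const (by simpa [hk] using hCk)
  obtain ⟨ε, hε, hlt⟩ := Metric.eventually_nhds_iff.1 hlt
  filter_upwards [Ico_mem_nhdsGE (lt_min hε hb)] with r hr
  have hrb : r < b := hr.2.trans_le (min_le_right _ _)
  have hslope : ∀ s ∈ Set.Icc 0 r, barrierSlope k β b s ≤ C * s := by
    intro s hs
    have hsb : |s| < b := by rw [abs_of_nonneg hs.1]; exact hs.2.trans_lt hrb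
    refine le_of_pow_le_pow_left₀ hk (mul_nonneg hC hs.1) ?_
    refine (barrierSlope_pow_le hk hβ hb hsb).trans ?_
    rw [abs_of_nonneg hs.1, mul_pow, mul_comm (C ^ k)]
    refine mul_le_mul_of_nonneg_left ?_ (pow_nonneg hs.1 k)
    have := hlt (y := s) (by
      rw [Real.dist_eq, sub_zero, abs_of_nonneg hs.1]
      exact hs.2.trans_lt (hr.2.trans_le (min_le_left _ _)))
    rw [abs_of_nonneg hs.1] at this
    exact this.le
  calc barrier k β b r ≤ ∫ s in (0 : ℝ)..r, C * s := by
        refine intervalIntegral.integral_mono_on hr.1 ?_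
          ((continuous_const.mul continuous_id).intervalIntegrable _ _) hslope
        refine ((continuousOn_barrierSlope hk hb).mono ?_).intervalIntegrable
        exact Set.ordConnected_Ioo.uIcc_subset ⟨by linarith, hb⟩ ⟨by linarith [hr.1], hrb⟩
    _ = C / 2 * r ^ 2 := by
        rw [intervalIntegral.integral_const_mul, integral_id]; ring

end Barrier

/-! ### Contact of `u` with the barrier. -/

section Contact

variable {n k : ℕ} {Ω : Set (EuclideanSpace ℝ (Fin n))} {u : EuclideanSpace ℝ (Fin n) → ℝ}
  {x x₀ : EuclideanSpace ℝ (Fin n)} {β b : ℝ}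

theorem hasDerivAt_norm_line {z w : EuclideanSpace ℝ (Fin n)} {t : ℝ} (h : z + t • w ≠ 0) :
    HasDerivAt (fun t : ℝ => ‖z + t • w‖) ((inner ℝ z w + t * ‖w‖ ^ 2) / ‖z + t • w‖) t := by
  have hline : HasDerivAt (fun t : ℝ => z + t • w) w t := by
    simpa using ((hasDerivAt_id t).smul_const w).const_add z
  have h1 := hline.norm_sq.sqrt (by positivity)
  simp only [Real.sqrt_sq (norm_nonneg _)] at h1
  convert h1 using 1
  rw [inner_add_left, inner_smul_left, real_inner_self_eq_norm_sq, RCLike.conj_to_real,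
    mul_div_mul_left _ _ two_ne_zero]

theorem dotProduct_self_eq_norm_sq (w : EuclideanSpace ℝ (Fin n)) :
    w.ofLp ⬝ᵥ w.ofLp = ‖w‖ ^ 2 := by
  rw [← real_inner_self_eq_norm_sq, EuclideanSpace.inner_eq_star_dotProduct, star_trivial]

/-- First and second order information where the barrier touches `u` away from its centre. -/
theorem contact_of_ne (hΩ : IsOpen Ω) (hu : ContDiffOn ℝ 2 u Ω) (hx : x ∈ Ω) (hk : k ≠ 0)
    (hb : 0 < b) (hne : x ≠ x₀) (hxb : ‖x - x₀‖ < b)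
    (hmax : IsLocalMax (fun y => u y - barrier k β b ‖y - x₀‖) x) {q : ℝ}
    (hq : HasDerivAt (barrierSlope k β b) q ‖x - x₀‖) (w : EuclideanSpace ℝ (Fin n)) :
    fderiv ℝ u x w = barrierSlope k β b ‖x - x₀‖ * (inner ℝ (x - x₀) w / ‖x - x₀‖) ∧
    w.ofLp ⬝ᵥ (hessianMatrix u x).mulVec w.ofLp ≤ q * (inner ℝ (x - x₀) w / ‖x - x₀‖) ^ 2
      + barrierSlope k β b ‖x - x₀‖ / ‖x - x₀‖
        * (‖w‖ ^ 2 - (inner ℝ (x - x₀) w / ‖x - x₀‖) ^ 2) := by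
  set z := x - x₀ with hz
  have hz0 : z ≠ 0 := sub_ne_zero.2 hne
  have hr : 0 < ‖z‖ := norm_pos_iff.2 hz0
  have hcont : Continuous fun t : ℝ => z + t • w := by fun_prop
  have hn0 : ∀ᶠ t in 𝓝 (0 : ℝ), z + t • w ≠ 0 :=
    hcont.continuousAt.eventually_ne (by simpa using hz0)
  have hnb : ∀ᶠ t in 𝓝 (0 : ℝ), ‖z + t • w‖ < b :=
    hcont.norm.continuousAt.eventually_lt_const (by simpa using hxb)
  have hd : ∀ᶠ t in 𝓝 (0 : ℝ), HasDerivAt (fun t : ℝ => barrier k β b ‖z + t • w‖)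
      (barrierSlope k β b ‖z + t • w‖ * ((inner ℝ z w + t * ‖w‖ ^ 2) / ‖z + t • w‖)) t := by
    filter_upwards [hn0, hnb] with t h1 h2
    exact (hasDerivAt_barrier hk hb (by rwa [abs_norm])).comp t (hasDerivAt_norm_line h1)
  have hnorm := hasDerivAt_norm_line (z := z) (w := w) (t := 0) (by simpa using hz0)
  simp only [zero_smul, add_zero, zero_mul] at hnorm
  have hnum : HasDerivAt (fun t : ℝ => inner ℝ z w + t * ‖w‖ ^ 2) (‖w‖ ^ 2) 0 := by
    simpa using ((hasDerivAt_id (0 : ℝ)).mul_const (‖w‖ ^ 2)).const_add (inner ℝ z w)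
  have hslope : HasDerivAt (fun t : ℝ => barrierSlope k β b ‖z + t • w‖)
      (q * (inner ℝ z w / ‖z‖)) 0 := by
    have hq' : HasDerivAt (barrierSlope k β b) q ‖z + (0 : ℝ) • w‖ := by simpa using hq
    exact hq'.comp (0 : ℝ) hnorm
  -- The product rule separates the radial part of the second derivative, with curvature q, from the
  -- tangential part, with curvature p/‖z‖.
  have hsecond := hslope.mul (hnum.div hnorm (by simpa using hz0))
  have hlm : IsLocalMax (fun t : ℝ => u (x + t • w) - barrier k β b ‖z + t • w‖) 0 := by
    have hline : Filter.Tendsto (fun t : ℝ => x + t • w) (𝓝 0) (𝓝 x) := by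
      have : Continuous fun t : ℝ => x + t • w := by fun_prop
      simpa using this.tendsto 0
    filter_upwards [hline.eventually hmax] with t ht
    simpa [hz, add_sub_right_comm] using ht
  obtain ⟨h1, h2⟩ := hessianMatrix_le_of_isLocalMax_line hΩ hu hx w hd hsecond hlm
  simp only [zero_smul, add_zero, zero_mul] at h1 h2
  refine ⟨h1, h2.trans_eq ?_⟩
  simp only [Pi.div_apply, zero_smul, add_zero, zero_mul]
  field_simp

/-- First and second order information where a paraboloid touches `u` at its centre. -/
theorem contact_paraboloid (hΩ : IsOpen Ω) (hu : ContDiffOn ℝ 2 u Ω) (hx : x ∈ Ω) {C : ℝ}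
    (hmax : IsLocalMax (fun y => u y - C / 2 * ‖y - x‖ ^ 2) x) (w : EuclideanSpace ℝ (Fin n)) :
    fderiv ℝ u x w = 0 ∧ w.ofLp ⬝ᵥ (hessianMatrix u x).mulVec w.ofLp ≤ C * ‖w‖ ^ 2 := by
  have hd : ∀ t : ℝ, HasDerivAt (fun t : ℝ => C / 2 * ‖w‖ ^ 2 * t ^ 2) (C * ‖w‖ ^ 2 * t) t := by
    intro t
    refine ((hasDerivAt_pow 2 t).const_mul (C / 2 * ‖w‖ ^ 2)).congr_deriv ?_
    push_cast
    ring
  have hd2 : HasDerivAt (fun t : ℝ => C * ‖w‖ ^ 2 * t) (C * ‖w‖ ^ 2) 0 := by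
    simpa using (hasDerivAt_id (0 : ℝ)).const_mul (C * ‖w‖ ^ 2)
  have hlm : IsLocalMax (fun t : ℝ => u (x + t • w) - C / 2 * ‖w‖ ^ 2 * t ^ 2) 0 := by
    have hline : Filter.Tendsto (fun t : ℝ => x + t • w) (𝓝 0) (𝓝 x) := by
      have : Continuous fun t : ℝ => x + t • w := by fun_prop
      simpa using this.tendsto 0
    filter_upwards [hline.eventually hmax] with t ht
    simp only [add_sub_cancel_left, norm_smul, sub_self, norm_zero, mul_pow, Real.norm_eq_abs,
      sq_abs, zero_smul, add_zero] at ht ⊢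
    linarith
  obtain ⟨h1, h2⟩ := hessianMatrix_le_of_isLocalMax_line hΩ hu hx w (.of_forall hd) hd2 hlm
  exact ⟨by simpa using h1, h2⟩

theorem gradient_eq_of_fderiv {v : EuclideanSpace ℝ (Fin n)}
    (h : ∀ w, fderiv ℝ u x w = inner ℝ v w) : gradient u x = v := by
  rw [gradient, LinearIsometryEquiv.symm_apply_eq]
  ext w
  simp [h]

/-- A `C²` function minus the barrier has an interior maximum on a suitable ball. -/
theorem exists_isLocalMax_sub_barrier (hΩ : IsOpen Ω) (hu : ContDiffOn ℝ 2 u Ω) (hk : k ≠ 0)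
    (hβ : 0 < β) (hb : 0 < b) (hball : Metric.closedBall x₀ b ⊆ Ω) :
    ∃ x, ‖x - x₀‖ < b ∧ IsLocalMax (fun y => u y - barrier k β b ‖y - x₀‖) x := by
  have hdc : ContinuousOn (fun y => ‖fderiv ℝ u y‖) (Metric.closedBall x₀ b) :=
    ((hu.continuousOn_fderiv_of_isOpen hΩ (by norm_num)).mono hball).norm
  obtain ⟨L, hL⟩ := (isCompact_closedBall x₀ b).bddAbove_image hdc
  -- L bounds |Du| on the whole ball, and at radius r the barrier is steeper than L.
  obtain ⟨r, hr0, hrb, hrL⟩ := exists_lt_barrierSlope hk hβ hb L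
  have hsub : Metric.closedBall x₀ r ⊆ Metric.closedBall x₀ b :=
    Metric.closedBall_subset_closedBall hrb.le
  have hvc : ContinuousOn (fun y => u y - barrier k β b ‖y - x₀‖) (Metric.closedBall x₀ r) := by
    refine (hu.continuousOn.mono (hsub.trans hball)).sub fun y hy => ?_
    have hyb : |‖y - x₀‖| < b := by
      rw [abs_norm]; exact (mem_closedBall_iff_norm.1 hy).trans_lt hrb
    refine ContinuousAt.continuousWithinAt ?_
    exact ContinuousAt.comp (f := fun y => ‖y - x₀‖) (g := barrier k β b)
      (hasDerivAt_barrier hk hb hyb).continuousAt (by fun_prop)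
  obtain ⟨x, hx, hmax⟩ := (isCompact_closedBall x₀ r).exists_isMaxOn
    (Metric.nonempty_closedBall.2 hr0.le) hvc
  have hxr := mem_closedBall_iff_norm.1 hx
  rcases hxr.lt_or_eq with hlt | heq
  · exact ⟨x, hlt.trans hrb, hmax.isLocalMax (Metric.closedBall_mem_nhds_of_mem
      (mem_ball_iff_norm.2 hlt))⟩
  -- A maximum on the sphere is impossible: moving inward along -z, u falls at rate at most L r
  -- while the barrier falls at rate p(r) r > L r, so the difference increases.
  exfalso
  set z := x - x₀ with hz
  have hxΩ : x ∈ Ω := hball (hsub hx)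
  have hline : HasDerivAt (fun t : ℝ => x + t • (-z)) (-z) 0 := by
    simpa using ((hasDerivAt_id (0 : ℝ)).smul_const (-z)).const_add x
  have hdu : HasDerivAt (fun t : ℝ => u (x + t • (-z))) (fderiv ℝ u x (-z)) 0 := by
    have hdiff : DifferentiableAt ℝ u x :=
      (hu.contDiffAt (hΩ.mem_nhds hxΩ)).differentiableAt (by norm_num)
    exact HasFDerivAt.comp_hasDerivAt (0 : ℝ) (by simpa using hdiff.hasFDerivAt) hline
  have hradius : HasDerivAt (fun t : ℝ => (1 - t) * r) (-r) 0 := by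
    simpa using ((hasDerivAt_id (0 : ℝ)).const_sub 1).mul_const r
  have hdv : HasDerivAt (fun t : ℝ => barrier k β b ((1 - t) * r))
      (barrierSlope k β b r * (-r)) 0 := by
    have hv : HasDerivAt (barrier k β b) (barrierSlope k β b r) ((1 - 0) * r) := by
      simpa using hasDerivAt_barrier hk hb (by rwa [abs_of_pos hr0])
    exact hv.comp (0 : ℝ) hradius
  have hle : ∀ᶠ t in 𝓝[>] (0 : ℝ),
      u (x + t • (-z)) - barrier k β b ((1 - t) * r)
        ≤ u (x + (0 : ℝ) • (-z)) - barrier k β b ((1 - 0) * r) := by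
    filter_upwards [Ioo_mem_nhdsGT (zero_lt_one (α := ℝ))] with t ht
    have hnorm : ‖x + t • (-z) - x₀‖ = (1 - t) * r := by
      rw [show x + t • (-z) - x₀ = (1 - t) • z by rw [hz]; module, norm_smul, heq,
        Real.norm_of_nonneg (by linarith [ht.2])]
    have : u (x + t • (-z)) - barrier k β b ‖x + t • (-z) - x₀‖
        ≤ u x - barrier k β b ‖x - x₀‖ := hmax (show x + t • (-z) ∈ Metric.closedBall x₀ r by
      rw [mem_closedBall_iff_norm, hnorm]
      nlinarith [ht.1])
    rw [hnorm, ← hz, heq] at this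
    rwa [zero_smul, add_zero, sub_zero, one_mul]
  have hder := (hdu.sub hdv).hasDerivWithinAt (s := Set.Ioi 0)
  have hle0 : fderiv ℝ u x (-z) - barrierSlope k β b r * (-r) ≤ 0 := by
    have hs := hasDerivWithinAt_iff_tendsto_slope' (by simp) |>.1 hder
    refine le_of_tendsto hs ?_
    filter_upwards [hle, self_mem_nhdsWithin] with t ht ht0
    rw [slope_def_field]
    refine div_nonpos_of_nonpos_of_nonneg ?_ ?_
    · exact sub_nonpos.2 ht
    · rw [sub_zero]; exact le_of_lt ht0
  have hbound : |fderiv ℝ u x (-z)| ≤ L * r := by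
    refine ((fderiv ℝ u x).le_opNorm (-z)).trans ?_
    rw [norm_neg, heq]
    exact mul_le_mul_of_nonneg_right (hL ⟨x, hsub hx, rfl⟩) hr0.le
  nlinarith [abs_le.1 hbound, mul_pos (sub_pos.2 hrL) hr0]

end Contact

/-! ### The differential inequality and the contradiction. -/

section Nonexistence

variable {n k : ℕ} {Ω : Set (EuclideanSpace ℝ (Fin n))} {u : EuclideanSpace ℝ (Fin n) → ℝ}

/-- The differential inequality at an interior maximum of `u` minus the barrier. -/
theorem exists_hessianOperator_lt [NeZero n] (hk : k ≠ 0) (hkn : k ≤ n) (hΩ : IsOpen Ω)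
    (hu : ContDiffOn ℝ 2 u Ω) (hconv : IsKConvexOn k u Ω)
    (hpos : ∀ x ∈ Ω, 0 < hessianOperator k u x) {M α b : ℝ} (hα : 1 < α)
    (hb : 0 < b) (hbM : n.choose k * (1 / (α - 1) / b ^ k) < M) {x₀ : EuclideanSpace ℝ (Fin n)}
    (hball : Metric.closedBall x₀ b ⊆ Ω) :
    ∃ x ∈ Ω, hessianOperator k u x < M * (1 + ‖gradient u x‖ ^ k) ^ α := by
  have hα1 : 0 < α - 1 := sub_pos.2 hα
  -- This β solves βα = β + 1.
  set β := 1 / (α - 1) with hβdef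
  have hβ : 0 < β := by positivity
  have hk1 : 1 ≤ k := Nat.one_le_iff_ne_zero.2 hk
  have hN : (0 : ℝ) < n.choose k := by exact_mod_cast Nat.choose_pos hkn
  obtain ⟨x, hxb, hmax⟩ := exists_isLocalMax_sub_barrier hΩ hu hk hβ hb hball
  have hx : x ∈ Ω := hball (mem_closedBall_iff_norm.2 hxb.le)
  refine ⟨x, hx, ?_⟩
  have hA := hessianMatrix_isHermitian hΩ hu hx
  rcases eq_or_ne x x₀ with rfl | hne
  -- At the centre `barrierSlope` is even, with a possible kink, so a paraboloid of curvature C, C^k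
  -- = E, is used instead. The strict gap in `hbM` leaves room for E between β/b^k and M/C(n,k).
  · obtain ⟨E, hE1, hE2⟩ := exists_between ((lt_div_iff₀' hN).2 hbM)
    have hE0 : 0 < E := lt_trans (by positivity) hE1
    set C := E ^ (1 / (k : ℝ)) with hC
    have hCk : C ^ k = E := by rw [hC, one_div, Real.rpow_inv_natCast_pow hE0.le hk]
    have hC0 : 0 ≤ C := Real.rpow_nonneg hE0.le _
    have hev := eventually_barrier_le hk hβ hb hC0 (hE1.trans_eq hCk.symm)
    have htend : Filter.Tendsto (fun y => ‖y - x‖) (𝓝 x) (𝓝[≥] 0) := by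
      refine tendsto_nhdsWithin_iff.2 ⟨?_, .of_forall fun y => norm_nonneg _⟩
      have : Continuous fun y => ‖y - x‖ := by fun_prop
      simpa using this.tendsto x
    have hlm : IsLocalMax (fun y => u y - C / 2 * ‖y - x‖ ^ 2) x := by
      filter_upwards [hmax, htend.eventually hev] with y h1 h2
      simp only [sub_self, norm_zero, barrier, intervalIntegral.integral_same] at h1 h2 ⊢
      linarith
    have hcontact := contact_paraboloid hΩ hu hx hlm
    have hgrad : gradient u x = 0 := gradient_eq_of_fderiv fun w => by simp [(hcontact w).1]
    have hform : ∀ w : Fin n → ℝ,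
        w ⬝ᵥ (hessianMatrix u x).mulVec w ≤ C * (w ⬝ᵥ w) := fun w => by
      have := (hcontact (WithLp.toLp 2 w)).2
      rwa [← dotProduct_self_eq_norm_sq] at this
    -- No direction is distinguished: e = 0 and g = G = C.
    have hle := elemSymm_symmEigenvalues_le hkn hA (hconv x hx) (hpos x hx) 0 hform
      (fun w _ => hform w) hCk.le (by rw [← pow_succ, Nat.sub_add_cancel hk1, hCk])
    rw [hgrad, norm_zero, zero_pow hk, add_zero, Real.one_rpow, mul_one]
    exact hle.trans_lt ((lt_div_iff₀' hN).1 hE2)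
  · set z := x - x₀ with hz
    have hr : 0 < ‖z‖ := norm_pos_iff.2 (sub_ne_zero.2 hne)
    have hra : |‖z‖| < b := by rwa [abs_norm]
    obtain ⟨q, hq, hqeq⟩ := exists_hasDerivAt_barrierSlope (k := k) (β := β) hk hβ hb hr hxb
    have hcontact := contact_of_ne hΩ hu hx hk hb hne hxb hmax hq
    rw [← hz] at hcontact
    set p := barrierSlope k β b ‖z‖ with hp
    have hp0 : 0 < p := barrierSlope_pos hk hβ hb hr hxb
    have hX := one_sub_pow_div_pos hk hb hra
    have hpk := barrierSlope_pow hk hβ hb hra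
    have hple := barrierSlope_pow_le hk hβ hb hra
    rw [abs_norm] at hX hpk hple
    rw [← hp] at hpk hple
    set X := 1 - ‖z‖ ^ k / b ^ k with hXdef
    set E := β / b ^ k * X ^ (-(β + 1)) with hE
    have hgrad : gradient u x = (p / ‖z‖) • z := gradient_eq_of_fderiv fun w => by
      rw [(hcontact w).1, inner_smul_left, RCLike.conj_to_real]; ring
    have hgradnorm : ‖gradient u x‖ = p := by
      rw [hgrad, norm_smul, Real.norm_of_nonneg (by positivity), div_mul_cancel₀ _ hr.ne']
    have hgE : (p / ‖z‖) ^ k ≤ E := by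
      rw [div_pow, div_le_iff₀' (by positivity)]; exact hple
    have hqE : (p / ‖z‖) ^ (k - 1) * q = E := by
      rw [div_pow, div_mul_eq_mul_div, hqeq, mul_div_cancel_left₀ _ (by positivity)]
    -- Cancel (p/‖z‖)^(k-1) in (p/‖z‖)^k ≤ E = (p/‖z‖)^(k-1) q.
    have hgq : p / ‖z‖ ≤ q := by
      have h := hgE.trans_eq hqE.symm
      rw [← Nat.sub_add_cancel hk1, pow_succ, Nat.add_sub_cancel] at h
      exact le_of_mul_le_mul_left h (by positivity)
    have hle := elemSymm_symmEigenvalues_le (G := q) hkn hA (hconv x hx) (hpos x hx) z.ofLp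
      (fun w => ?_) (fun w hw => ?_) hgE hqE.le
    -- Hence (1 + p^k)^α = X^(-(β+1)), the same power as in E, and only the constants remain to be
    -- compared.
    · have hbeta : (-β) * α = -(β + 1) := by
        rw [hβdef]; field_simp; ring
      rw [hgradnorm, hpk, add_sub_cancel, ← Real.rpow_mul hX.le, hbeta]
      refine hle.trans_lt ?_
      rw [hE, ← mul_assoc]
      exact mul_lt_mul_of_pos_right hbM (Real.rpow_pos_of_pos hX _)
    · have h := (hcontact (WithLp.toLp 2 w)).2
      have hcs : (inner ℝ z (WithLp.toLp 2 w) / ‖z‖) ^ 2 ≤ ‖WithLp.toLp 2 w‖ ^ 2 := by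
        rw [sq_le_sq, abs_div, abs_norm, abs_norm, div_le_iff₀' hr]
        exact abs_real_inner_le_norm _ _
      rw [← dotProduct_self_eq_norm_sq] at h hcs
      refine h.trans ?_
      nlinarith [mul_le_mul_of_nonneg_right hgq (sub_nonneg.2 hcs)]
    · have h := (hcontact (WithLp.toLp 2 w)).2
      have hinner : inner ℝ z (WithLp.toLp 2 w) = 0 := by
        rw [EuclideanSpace.inner_eq_star_dotProduct, star_trivial, dotProduct_comm]; exact hw
      rw [hinner, ← dotProduct_self_eq_norm_sq] at h
      simpa using h

/-- `C(n, k) ≤ (k + 1) C(n - 1, k)` for `k < n`, in terms of factorials. -/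
theorem choose_le_succ_mul_factorial_div (hk : k < n) :
    (n.choose k : ℝ) ≤ ((k : ℝ) + 1) * ((n - 1)! : ℝ) / ((k ! : ℝ) * ((n - k - 1)! : ℝ)) := by
  obtain ⟨d, rfl⟩ := Nat.exists_eq_add_of_lt hk
  rw [show k + d + 1 - 1 = k + d by omega, show k + d + 1 - k - 1 = d by omega,
    le_div_iff₀ (by positivity)]
  have h := Nat.choose_mul_factorial_mul_factorial (show k ≤ k + d + 1 by omega)
  rw [show k + d + 1 - k = d + 1 by omega, Nat.factorial_succ d, Nat.factorial_succ (k + d)] at h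
  have hR : ((k + d + 1).choose k : ℝ) * k ! * ((d + 1) * d !) = (k + d + 1) * (k + d)! := by
    exact_mod_cast h
  have hd : (0 : ℝ) < d + 1 := by positivity
  refine le_of_mul_le_mul_right ?_ hd
  calc _ = ((k + d + 1).choose k : ℝ) * k ! * ((d + 1) * d !) := by ring
    _ = (k + d + 1) * ((k + d)! : ℝ) := hR
    -- Here d = n - k - 1, and k + d + 1 ≤ (k + 1)(d + 1).
    _ ≤ ((k + 1) * (d + 1)) * ((k + d)! : ℝ) := by
        refine mul_le_mul_of_nonneg_right ?_ (by positivity)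
        nlinarith [(Nat.cast_nonneg k : (0 : ℝ) ≤ k), (Nat.cast_nonneg d : (0 : ℝ) ≤ d)]
    _ = _ := by ring

end Nonexistence

theorem theorem1p2 (n k : ℕ) (hk : 1 ≤ k) (hkn : k ≤ n - 1)
    (Ω : Set (EuclideanSpace ℝ (Fin n))) (hΩ : IsOpen Ω) (hΩc : IsConnected Ω)
    (ψ : EuclideanSpace ℝ (Fin n) → ℝ → EuclideanSpace ℝ (Fin n) → ℝ)
    (α M : ℝ) (hα : 1 < α) (hM : 0 < M)
    (hψ : ∀ x ∈ Ω, ∀ (z : ℝ) (p : EuclideanSpace ℝ (Fin n)),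
      M * (1 + ‖p‖ ^ k) ^ α ≤ ψ x z p)
    (a : ℝ)
    (ha : (((k : ℝ) + 1) * ((n - 1)! : ℝ) / (M * (α - 1) * (k ! : ℝ) * ((n - k - 1)! : ℝ)))
      ^ (1 / (k : ℝ)) < a)
    (x₀ : EuclideanSpace ℝ (Fin n)) (hball : Metric.ball x₀ a ⊆ Ω) :
    ¬ ∃ u : EuclideanSpace ℝ (Fin n) → ℝ, IsKConvexBlowUpSolution k Ω ψ u := by
  rintro ⟨u, hu⟩
  have hk0 : k ≠ 0 := by omega
  have : NeZero n := ⟨by omega⟩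
  have hα1 : 0 < α - 1 := sub_pos.2 hα
  set A := ((k : ℝ) + 1) * ((n - 1)! : ℝ) / (M * (α - 1) * (k ! : ℝ) * ((n - k - 1)! : ℝ)) with hA
  have hA0 : 0 < A := by positivity
  -- Shrinking a to b puts the closed ball inside Ω while keeping the strict bound A < b^k.
  obtain ⟨b, hAb, hba⟩ := exists_between ha
  have hb : 0 < b := (Real.rpow_pos_of_pos hA0 _).trans hAb
  have hAbk : A < b ^ k := by
    have := pow_lt_pow_left₀ hAb (Real.rpow_nonneg hA0.le _) hk0
    rwa [one_div, Real.rpow_inv_natCast_pow hA0.le hk0] at this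
  have hbM : n.choose k * (1 / (α - 1) / b ^ k) < M := by
    have hchoose : (n.choose k : ℝ) ≤ M * (α - 1) * A := by
      refine (choose_le_succ_mul_factorial_div (by omega)).trans_eq ?_
      rw [hA]
      field_simp
    rw [div_div, mul_one_div, div_lt_iff₀ (by positivity), ← mul_assoc]
    exact hchoose.trans_lt (mul_lt_mul_of_pos_left hAbk (by positivity))
  -- This also makes S_k(D²u) positive, which moves the eigenvalues from the closure of Γ_k into the
  -- region where S_k is monotone.
  have hge : ∀ x ∈ Ω, M * (1 + ‖gradient u x‖ ^ k) ^ α ≤ hessianOperator k u x := fun x hx => by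
    rw [hu.equation x hx]
    exact hψ x hx _ _
  obtain ⟨x, hx, hlt⟩ := exists_hessianOperator_lt hk0 (by omega) hΩ hu.contDiffOn hu.kConvex
    (fun x hx => lt_of_lt_of_le (by positivity) (hge x hx)) hα hb hbM
    ((Metric.closedBall_subset_ball hba).trans hball)
  exact hlt.not_ge (hge x hx)
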